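/- Let $\mathcal A$ be an essentially small abelian category with enough projectives and of finite global dimension, and let $m>0$ be an integer. An $m$-periodic complex over $\mathcal A$ is a family $(V^i,d^i\colon V^i\to V^{i+1})_{i\in\mathbb Z/m}$ with $d^{i+1}d^i=0$. Let $K_m(\mathcal A)$ be the category of $m$-periodic complexes and homotopy classes of chain maps, and let the $m$-periodic derived category $D_m(\mathcal A)$ be the localization of $K_m(\mathcal A)$ with respect to quasi-isomorphisms. Its suspension is induced by $V\mapsto V[1]=(V^{i+1},-d^{i+1})_i$, and its exact triangles are those isomorphic to images of mapping cone triangles $V\xrightarrow{f} W\to \mathrm{Cone}(f)\to V[1]$. For an essentially small abelian (resp. triangulated) category, the Grothendieck group $K_0$ is the free abelian group on isomorphism classes of objects modulo the relations $[X]-[Y]+[Z]=0$ for all short exact sequences $0\to X\to Y\to Z\to 0$ (resp. exact triangles $X\to Y\to Z\to X[1]$). Then $D_m(\mathcal A)$ is essentially small, so that $K_0(D_m(\mathcal A))$ is defined, and the natural functor $\mathcal A\to D_m(\mathcal A)$, sending an object $M$ to the complex with $M$ in degree $0$ and zero differential (and zero in the other degrees), induces isomorphisms $$K_0(\mathcal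 A)\xrightarrow{\ \sim\ } K_0(D_m(\mathcal A)),\quad [M]\mapsto[M]\qquad\text{if $m$ is even},$$ $$K_0(\mathcal A)\otimes_{\mathbb Z}\mathbb F_2\xrightarrow{\ \sim\ } K_0(D_m(\mathcal A)),\quad [M]\otimes 1\mapsto[M]\qquad\text{if $m$ is odd}.$$ -/

import Mathlib

open CategoryTheory CategoryTheory.Category CategoryTheory.Limits CategoryTheory.Pretriangulated
open scoped TensorProduct

universe w v u

namespace PeriodicDerived

/-! ### Grothendieck groups -/

/-- The free abelian group on the isomorphism classes of objects of `C`, modulo the relations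
`[X] - [Y] + [Z] = 0` for all triples `(X, Y, Z)` satisfying `E`. -/
abbrev K0OfRelation {C : Type u} [Category.{v} C] (E : C → C → C → Prop) : Type u :=
  FreeAbelianGroup (_root_.Quotient (isIsomorphicSetoid C)) ⧸
    AddSubgroup.closure {x : FreeAbelianGroup (_root_.Quotient (isIsomorphicSetoid C)) |
      ∃ X Y Z : C, E X Y Z ∧
        x = FreeAbelianGroup.of (_root_.Quotient.mk _ X) - FreeAbelianGroup.of (_root_.Quotient.mk _ Y)
          + FreeAbelianGroup.of (_root_.Quotient.mk _ Z)}

/-- The class `[X]` of an object `X`. -/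
def K0OfRelation.cls {C : Type u} [Category.{v} C] (E : C → C → C → Prop) (X : C) :
    K0OfRelation E :=
  QuotientAddGroup.mk (FreeAbelianGroup.of (_root_.Quotient.mk (isIsomorphicSetoid C) X))

/-- There is a short exact sequence `0 ⟶ X ⟶ Y ⟶ Z ⟶ 0`. -/
def FitsInShortExact {A : Type u} [Category.{v} A] [Abelian A] (X Y Z : A) : Prop :=
  ∃ (f : X ⟶ Y) (g : Y ⟶ Z) (zero : f ≫ g = 0), (ShortComplex.mk f g zero).ShortExact

/-- The Grothendieck group of an abelian category. -/
abbrev K0Abelian (A : Type u) [Category.{v} A] [Abelian A] : Type u :=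
  K0OfRelation (FitsInShortExact (A := A))

/-- There is a triangle `X ⟶ Y ⟶ Z ⟶ X⟦1⟧` which belongs to the given class of triangles. -/
def FitsInTriangle {T : Type u} [Category.{v} T] [HasShift T ℤ] (dist : Set (Triangle T))
    (X Y Z : T) : Prop :=
  ∃ (f : X ⟶ Y) (g : Y ⟶ Z) (h : Z ⟶ X⟦(1 : ℤ)⟧), Triangle.mk f g h ∈ dist

/-- The Grothendieck group of a triangulated category whose exact triangles are
those in `dist`. -/
abbrev K0Triangulated {T : Type u} [Category.{v} T] [HasShift T ℤ] (dist : Set (Triangle T)) :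
    Type u :=
  K0OfRelation (FitsInTriangle dist)

/-! ### Finite global dimension -/

/-- There is a common finite bound for the projective dimensions of all the objects. -/
def HasFiniteGlobalDimension (A : Type u) [Category.{v} A] [Abelian A] : Prop :=
  ∃ d : ℕ, ∀ X : A, HasProjectiveDimensionLE X d

/-! ### Periodic complexes and their shift -/

section Complexes

variable (C : Type u) [Category.{v} C] [Preadditive C] (m : ℕ)

/-- The category of `m`-periodic complexes: families of objects and differentials
`V i ⟶ V (i + 1)` of square zero, indexed by `ZMod m`. -/
abbrev PeriodicComplex : Type (max u v) := HomologicalComplex C (ComplexShape.up (ZMod m))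

instance : DecidableRel (ComplexShape.up (ZMod m)).Rel :=
  fun i j => inferInstanceAs (Decidable (i + 1 = j))

/-- The shift by `n`: it sends `V` to the complex which is `V (i + n)` in degree `i`, with
differential multiplied by `(-1) ^ n`. -/
@[simps]
def shiftComplex (n : ℤ) : PeriodicComplex C m ⥤ PeriodicComplex C m where
  obj K :=
    { X := fun i => K.X (i + (n : ZMod m))
      d := fun i j => n.negOnePow • K.d (i + (n : ZMod m)) (j + (n : ZMod m))
      d_comp_d' := by
        intros
        simp only [Linear.comp_units_smul, Linear.units_smul_comp,
          HomologicalComplex.d_comp_d, smul_zero]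
      shape := fun i j hij => by
        rw [K.shape, smul_zero]
        intro hij'
        apply hij
        change i + (n : ZMod m) + 1 = j + (n : ZMod m) at hij'
        change i + 1 = j
        exact add_right_cancel (b := (n : ZMod m)) (by rw [← hij']; ring) }
  map φ :=
    { f := fun i => φ.f (i + (n : ZMod m))
      comm' := by
        intros
        dsimp
        simp only [Linear.comp_units_smul, HomologicalComplex.Hom.comm,
          Linear.units_smul_comp] }
  map_id := by intros; rfl
  map_comp := by intros; rfl

variable {C m} in
lemma d_comp_eqToHom (K : PeriodicComplex C m) (ε : ℤˣ) {i i' j j' : ZMod m} (hi : i = i')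
    (hj : j = j') :
    (ε • K.d i j) ≫ eqToHom (congrArg K.X hj) =
      eqToHom (congrArg K.X hi) ≫ (ε • K.d i' j') := by
  subst hi hj; simp

variable {C m} in
lemma f_comp_eqToHom {K L : PeriodicComplex C m} (φ : K ⟶ L) {i i' : ZMod m} (hi : i = i') :
    φ.f i = eqToHom (congrArg K.X hi) ≫ φ.f i' ≫ eqToHom (congrArg L.X hi.symm) := by
  subst hi; simp

lemma shiftComplex_zero : shiftComplex C m 0 = 𝟭 _ := by
  have h (i : ZMod m) : i + ((0 : ℤ) : ZMod m) = i := by simp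
  refine CategoryTheory.Functor.ext (fun K => HomologicalComplex.ext (funext fun i => congrArg K.X (h i))
    (fun i j _ => ?_)) (fun K L φ => ?_)
  · change ((0 : ℤ).negOnePow • K.d _ _) ≫ _ = _
    rw [Int.negOnePow_zero]
    refine (d_comp_eqToHom K 1 (h i) (h j)).trans ?_
    rw [one_smul]
    rfl
  · ext i
    rw [HomologicalComplex.comp_f, HomologicalComplex.comp_f, HomologicalComplex.eqToHom_f,
      HomologicalComplex.eqToHom_f]
    exact f_comp_eqToHom φ (h i)

lemma shiftComplex_add (a b : ℤ) :
    shiftComplex C m (a + b) = shiftComplex C m a ⋙ shiftComplex C m b := by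
  have h (i : ZMod m) : i + ((a + b : ℤ) : ZMod m) = i + (b : ZMod m) + (a : ZMod m) := by
    push_cast; ring
  refine CategoryTheory.Functor.ext (fun K => HomologicalComplex.ext (funext fun i => congrArg K.X (h i))
    (fun i j _ => ?_)) (fun K L φ => ?_)
  · change ((a + b).negOnePow • K.d _ _) ≫ _ = _ ≫ (b.negOnePow • (a.negOnePow • K.d _ _))
    rw [smul_smul, ← Int.negOnePow_add, add_comm b a]
    exact d_comp_eqToHom K _ (h i) (h j)
  · ext i
    rw [HomologicalComplex.comp_f, HomologicalComplex.comp_f, HomologicalComplex.eqToHom_f,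
      HomologicalComplex.eqToHom_f]
    exact f_comp_eqToHom φ (h i)

instance hasShiftComplex : HasShift (PeriodicComplex C m) ℤ := hasShiftMk _ _
  { F := shiftComplex C m
    zero := eqToIso (shiftComplex_zero C m)
    add := fun a b => eqToIso (shiftComplex_add C m a b)
    assoc_hom_app := fun a b c K => by simp [eqToHom_map]
    zero_add_hom_app := fun a K => by simp [eqToHom_map]
    add_zero_hom_app := fun a K => by simp }

variable {C m}

/-- The shift of a homotopy. -/
def shiftHomotopy {K L : PeriodicComplex C m} {φ ψ : K ⟶ L} (h : Homotopy φ ψ) (n : ℤ) :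
    Homotopy ((shiftComplex C m n).map φ) ((shiftComplex C m n).map ψ) where
  hom i j := n.negOnePow • h.hom (i + (n : ZMod m)) (j + (n : ZMod m))
  zero i j hij := by
    change (n.negOnePow • h.hom (i + (n : ZMod m)) (j + (n : ZMod m)) :
      K.X (i + (n : ZMod m)) ⟶ L.X (j + (n : ZMod m))) = 0
    rw [h.zero, smul_zero]
    intro hij'
    apply hij
    change j + (n : ZMod m) + 1 = i + (n : ZMod m) at hij'
    change j + 1 = i
    exact add_right_cancel (b := (n : ZMod m)) (by rw [← hij']; ring)
  comm i := by
    have h₁ : (ComplexShape.up (ZMod m)).Rel i (i + 1) := rfl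
    have h₂ : (ComplexShape.up (ZMod m)).Rel (i - 1) i := sub_add_cancel i 1
    have h₃ : (ComplexShape.up (ZMod m)).Rel (i + (n : ZMod m)) (i + 1 + (n : ZMod m)) := by
      change i + (n : ZMod m) + 1 = i + 1 + (n : ZMod m); ring
    have h₄ : (ComplexShape.up (ZMod m)).Rel (i - 1 + (n : ZMod m)) (i + (n : ZMod m)) := by
      change i - 1 + (n : ZMod m) + 1 = i + (n : ZMod m); ring
    have e := h.comm (i + (n : ZMod m))
    rw [dNext_eq _ h₃, prevD_eq _ h₄] at e
    let H (i j : ZMod m) : ((shiftComplex C m n).obj K).X i ⟶ ((shiftComplex C m n).obj L).X j :=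
      n.negOnePow • h.hom (i + (n : ZMod m)) (j + (n : ZMod m))
    have e' : φ.f (i + (n : ZMod m)) =
        (n.negOnePow • K.d (i + (n : ZMod m)) (i + 1 + (n : ZMod m))) ≫
          (n.negOnePow • h.hom (i + 1 + (n : ZMod m)) (i + (n : ZMod m))) +
        (n.negOnePow • h.hom (i + (n : ZMod m)) (i - 1 + (n : ZMod m))) ≫
          (n.negOnePow • L.d (i - 1 + (n : ZMod m)) (i + (n : ZMod m))) +
        ψ.f (i + (n : ZMod m)) := by
      simpa only [Linear.units_smul_comp, Linear.comp_units_smul, smul_smul,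
        Int.units_mul_self, one_smul] using e
    change _ = dNext i H + prevD i H + ((shiftComplex C m n).map ψ).f i
    rw [dNext_eq H h₁, prevD_eq H h₂]
    exact e'

variable (C m)

instance : (homotopic C (ComplexShape.up (ZMod m))).IsCompatibleWithShift ℤ :=
  ⟨fun n _ _ _ _ ⟨h⟩ => ⟨shiftHomotopy h n⟩⟩

noncomputable instance hasShiftHomotopyCategory :
    HasShift (HomotopyCategory C (ComplexShape.up (ZMod m))) ℤ :=
  inferInstanceAs (HasShift (CategoryTheory.Quotient (homotopic C (ComplexShape.up (ZMod m)))) ℤ)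

noncomputable instance commShiftQuotient :
    (HomotopyCategory.quotient C (ComplexShape.up (ZMod m))).CommShift ℤ :=
  Quotient.functor_commShift (homotopic C (ComplexShape.up (ZMod m))) ℤ

/-- The projection from the mapping cone of `φ : K ⟶ L` (which is `K (i + 1) ⊞ L i` in degree
`i`) to `K⟦1⟧`. -/
noncomputable def coneProj [HasBinaryBiproducts C] {K L : PeriodicComplex C m} (φ : K ⟶ L) :
    HomologicalComplex.homotopyCofiber φ ⟶ K⟦(1 : ℤ)⟧ where
  f i := HomologicalComplex.homotopyCofiber.fstX φ i (i + ((1 : ℤ) : ZMod m))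
    (by change i + 1 = _; simp)
  comm' i j hij := by
    have hj : (ComplexShape.up (ZMod m)).Rel j (j + ((1 : ℤ) : ZMod m)) := by
      change j + 1 = _; simp
    change _ ≫ ((1 : ℤ).negOnePow • K.d _ _) =
      HomologicalComplex.homotopyCofiber.d φ i j ≫ _
    have hi : i + ((1 : ℤ) : ZMod m) = j := by
      have : i + 1 = j := hij
      simpa using this
    refine Eq.trans ?_ (HomologicalComplex.homotopyCofiber.d_fstX φ i j _ hij hj).symm
    subst hi
    simp

/-- The triangle `K ⟶ L ⟶ cone φ ⟶ K⟦1⟧` attached to a morphism `φ : K ⟶ L`. -/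
noncomputable def coneTriangle [HasBinaryBiproducts C] {K L : PeriodicComplex C m} (φ : K ⟶ L) :
    Triangle (PeriodicComplex C m) :=
  Triangle.mk φ (HomologicalComplex.homotopyCofiber.inr φ) (coneProj C m φ)

end Complexes

/-! ### The periodic derived category -/

section Derived

variable (A : Type u) [Category.{v} A] [Abelian A] (m : ℕ)

/-- The short complexes computing the cohomology of `K⟦n⟧` in degree `i` and of `K` in
degree `i + n` are isomorphic. -/
noncomputable def shiftShortComplexIso (n : ℤ) (i : ZMod m) :
    shiftComplex A m n ⋙ HomologicalComplex.shortComplexFunctor A _ i ≅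
      HomologicalComplex.shortComplexFunctor A _ (i + (n : ZMod m)) :=
  have hp : (ComplexShape.up (ZMod m)).prev i + (n : ZMod m) =
      (ComplexShape.up (ZMod m)).prev (i + (n : ZMod m)) := by
    refine (ComplexShape.prev_eq' _ ?_).symm
    have : (ComplexShape.up (ZMod m)).prev i = i - 1 :=
      ComplexShape.prev_eq' _ (sub_add_cancel i 1)
    change (ComplexShape.up (ZMod m)).prev i + (n : ZMod m) + 1 = _
    rw [this]; ring
  have hn : (ComplexShape.up (ZMod m)).next i + (n : ZMod m) =
      (ComplexShape.up (ZMod m)).next (i + (n : ZMod m)) := by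
    refine (ComplexShape.next_eq' _ ?_).symm
    have : (ComplexShape.up (ZMod m)).next i = i + 1 := ComplexShape.next_eq' _ rfl
    change i + (n : ZMod m) + 1 = _
    rw [this]; ring
  NatIso.ofComponents (fun K => ShortComplex.isoMk
      (S₁ := (HomologicalComplex.shortComplexFunctor A _ i).obj ((shiftComplex A m n).obj K))
      (S₂ := (HomologicalComplex.shortComplexFunctor A _ (i + (n : ZMod m))).obj K)
      (n.negOnePow • K.XIsoOfEq hp) (Iso.refl (K.X (i + (n : ZMod m))))
      (n.negOnePow • K.XIsoOfEq hn)
      (by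
        change (n.negOnePow • (K.XIsoOfEq hp).hom) ≫ K.d _ _ = (n.negOnePow • K.d _ _) ≫ 𝟙 _
        simp)
      (by
        change 𝟙 _ ≫ K.d _ _ = (n.negOnePow • K.d _ _) ≫ (n.negOnePow • (K.XIsoOfEq hn).hom)
        simp [smul_smul]))
    (fun {K L} f => by
      ext
      · change f.f _ ≫ (n.negOnePow • (L.XIsoOfEq hp).hom) =
          (n.negOnePow • (K.XIsoOfEq hp).hom) ≫ f.f _
        simp [HomologicalComplex.XIsoOfEq_hom_naturality]
      · change f.f _ ≫ 𝟙 _ = 𝟙 _ ≫ f.f _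
        simp
      · change f.f _ ≫ (n.negOnePow • (L.XIsoOfEq hn).hom) =
          (n.negOnePow • (K.XIsoOfEq hn).hom) ≫ f.f _
        simp [HomologicalComplex.XIsoOfEq_hom_naturality])

lemma quasiIsoAt_shift_iff {K L : PeriodicComplex A m} (f : K ⟶ L) (n : ℤ) (i : ZMod m) :
    QuasiIsoAt ((shiftComplex A m n).map f) i ↔ QuasiIsoAt f (i + (n : ZMod m)) := by
  rw [_root_.quasiIsoAt_iff, _root_.quasiIsoAt_iff]
  exact ShortComplex.quasiIso_iff_of_arrow_mk_iso _ _
    (((Functor.mapArrowFunctor _ _).mapIso (shiftShortComplexIso A m n i)).app (Arrow.mk f))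

lemma quasiIso_shift_iff {K L : HomotopyCategory A (ComplexShape.up (ZMod m))} (f : K ⟶ L)
    (n : ℤ) : HomotopyCategory.quasiIso A _ (f⟦n⟧') ↔ HomotopyCategory.quasiIso A _ f := by
  obtain ⟨K, rfl⟩ := HomotopyCategory.quotient_obj_surjective K
  obtain ⟨L, rfl⟩ := HomotopyCategory.quotient_obj_surjective L
  obtain ⟨f, rfl⟩ := (HomotopyCategory.quotient A (ComplexShape.up (ZMod m))).map_surjective f
  have e := ((Functor.mapArrowFunctor _ _).mapIso
    ((HomotopyCategory.quotient A (ComplexShape.up (ZMod m))).commShiftIso n)).app (Arrow.mk f)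
  have h := (HomotopyCategory.quasiIso A (ComplexShape.up (ZMod m))).arrow_mk_iso_iff e
  refine h.symm.trans ?_
  refine (HomotopyCategory.quotient_map_mem_quasiIso_iff ((shiftComplex A m n).map f)).trans ?_
  rw [HomotopyCategory.quotient_map_mem_quasiIso_iff, HomologicalComplex.mem_quasiIso_iff,
    HomologicalComplex.mem_quasiIso_iff, _root_.quasiIso_iff, _root_.quasiIso_iff]
  refine ⟨fun H i => ?_, fun H i => (quasiIsoAt_shift_iff A m f n i).2 (H _)⟩
  have := (quasiIsoAt_shift_iff A m f n (i - (n : ZMod m))).1 (H _)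
  rwa [sub_add_cancel] at this

instance : (HomotopyCategory.quasiIso A (ComplexShape.up (ZMod m))).IsCompatibleWithShift ℤ :=
  ⟨fun n => by
    ext K L f
    exact quasiIso_shift_iff A m f n⟩

/-- The `m`-periodic derived category: the localization of the homotopy category of
`m`-periodic complexes with respect to quasi-isomorphisms. -/
abbrev PeriodicDerivedCategory : Type (max u v) :=
  (HomotopyCategory.quasiIso A (ComplexShape.up (ZMod m))).Localization

/-- The canonical functor from `m`-periodic complexes to the `m`-periodic derived category. -/
noncomputable abbrev toDerived : PeriodicComplex A m ⥤ PeriodicDerivedCategory A m :=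
  HomotopyCategory.quotient A _ ⋙ (HomotopyCategory.quasiIso A (ComplexShape.up (ZMod m))).Q

/-- The exact triangles of the `m`-periodic derived category: those isomorphic to the image
of the triangle of a mapping cone. -/
def exactTriangles : Set (Triangle (PeriodicDerivedCategory A m)) :=
  {T | ∃ (K L : PeriodicComplex A m) (φ : K ⟶ L),
    Nonempty (T ≅ (toDerived A m).mapTriangle.obj (coneTriangle A m φ))}

/-- The natural functor `A ⥤ D_m(A)`, which sends an object to the complex concentrated in
degree `0`. -/
noncomputable def stalkFunctor : A ⥤ PeriodicDerivedCategory A m :=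
  HomologicalComplex.single A (ComplexShape.up (ZMod m)) 0 ⋙ toDerived A m

/-- The Grothendieck group of the `m`-periodic derived category. -/
abbrev K0PeriodicDerived : Type (max u v) := K0Triangulated (exactTriangles A m)

end Derived

end PeriodicDerived

/-!
The Grothendieck group of the periodic derived category is computed by generators and an Euler
characteristic.

A short exact sequence of periodic complexes gives an exact triangle, because the mapping cone of a
monomorphism is quasi-isomorphic to the cokernel (`quasiIso_coneDesc`). In particular the stalk
functor induces a homomorphism `stalkHom` of Grothendieck groups. Every periodic complex is an
extension of two complexes with zero differential (cycles and boundaries), and these are iterated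
extensions of stalk complexes. Since the mapping cone of `K ⟶ 0` is a shift of `K`, moving a stalk
complex by one degree changes the sign of its class. Hence `stalkHom` is surjective
(`cls_mem_of_stalk_mem`), and going once around `ZMod m` shows that the class of a stalk complex
equals `(-1) ^ m` times itself, so that the target is killed by `2` if `m` is odd
(`two_nsmul_eq_zero`).

Conversely, an additive function `c` on `A` with values in `G` defines the Euler characteristic
`∑ i, s i • c (Hⁱ X)`, for signs `s` on `ZMod m` which alternate in their action on `G`: such signs
exist if `m` is even, or if `G` is killed by `2`. This only depends on the isomorphism class of `X`
in the derived category, and it agrees with the alternating sum over the terms of a complex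
(`IsAdditive.sum_homology_eq`), for which the relation of a mapping cone is immediate. On stalk
complexes it is `c`. Taking `c` to be the universal additive function, with values in `K₀(A)` or in
`K₀(A) ⊗ ZMod 2`, gives a left inverse of the homomorphism induced by the stalk functor.
-/

namespace PeriodicDerived

/-! ### Essential smallness -/

section Smallness

lemma essentiallySmall_homologicalComplex {ι : Type} (c : ComplexShape ι) (A : Type u)
    [Category.{v} A] [Preadditive A] [EssentiallySmall.{w} A] :
    EssentiallySmall.{w} (HomologicalComplex A c) := by
  -- a small model of `A` inherits a preadditive structure, so its complexes form a small category
  let e := equivSmallModel.{w} A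
  let : Preadditive (SmallModel.{w} A) := .ofFullyFaithful e.fullyFaithfulInverse
  have : e.inverse.Additive := ⟨fun {_ _ _ _} => e.fullyFaithfulInverse.homEquiv.apply_symm_apply _⟩
  have : e.symm.functor.Additive := this
  have : e.functor.Additive := e.symm.inverse_additive
  exact essentiallySmall_of_fully_faithful (e.functor.mapHomologicalComplex c)

lemma essentiallySmall_of_full_of_essSurj {C : Type*} [Category* C] {D : Type*} [Category* D]
    (F : C ⥤ D) [F.Full] [F.EssSurj] [EssentiallySmall.{w} C] : EssentiallySmall.{w} D := by
  rw [essentiallySmall_iff]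
  refine ⟨small_of_surjective (f := F.mapSkeleton.obj) fun Y => ?_, ⟨fun X Y => ?_⟩⟩
  · obtain ⟨X, ⟨e⟩⟩ := Functor.EssSurj.mem_essImage (F := F.mapSkeleton) Y
    exact ⟨X, skeleton_skeletal _ ⟨e⟩⟩
  · refine small_of_surjective (f := fun g : F.objPreimage X ⟶ F.objPreimage Y =>
      (F.objObjPreimageIso X).inv ≫ F.map g ≫ (F.objObjPreimageIso Y).hom) fun h => ?_
    obtain ⟨g, hg⟩ := F.map_surjective
      ((F.objObjPreimageIso X).hom ≫ h ≫ (F.objObjPreimageIso Y).inv)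
    exact ⟨g, by simp [hg]⟩

/-- The formal localization of a small model is small by construction, and localizing equivalent
categories with respect to corresponding classes of morphisms gives equivalent categories. -/
lemma essentiallySmall_localization {C : Type*} [Category* C] [EssentiallySmall.{w} C]
    (W : MorphismProperty C) [W.RespectsIso] : EssentiallySmall.{w} W.Localization := by
  let e := equivSmallModel.{w} C
  let Φ : LocalizerMorphism (W.inverseImage e.inverse) W := .ofEq (F := e.inverse) rfl
  have : Φ.IsInduced := ⟨rfl⟩
  have : Φ.functor.IsEquivalence := inferInstanceAs e.inverse.IsEquivalence
  have : Φ.IsLocalizedEquivalence := Φ.isLocalizedEquivalence_of_isInduced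
  exact .mk' (Φ.localizedFunctor (W.inverseImage e.inverse).Q W.Q).asEquivalence.symm

lemma essentiallySmall_periodicDerivedCategory (A : Type u) [Category.{v} A] [Abelian A]
    [EssentiallySmall.{w} A] (m : ℕ) : EssentiallySmall.{w} (PeriodicDerivedCategory A m) := by
  have := essentiallySmall_homologicalComplex.{w} (ComplexShape.up (ZMod m)) A
  have := essentiallySmall_of_full_of_essSurj.{w}
    (HomotopyCategory.quotient A (ComplexShape.up (ZMod m)))
  exact essentiallySmall_localization _

end Smallness

/-! ### Generators and the universal property of Grothendieck groups -/

section GrothendieckGroup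

namespace K0OfRelation

variable {C : Type u} [Category.{v} C] {E : C → C → C → Prop}

lemma cls_eq_of_iso {X Y : C} (e : X ≅ Y) : cls E X = cls E Y :=
  congrArg (fun x => QuotientAddGroup.mk (FreeAbelianGroup.of x))
    (_root_.Quotient.sound (s := isIsomorphicSetoid C) ⟨e⟩)

lemma cls_sub_cls_add_cls {X Y Z : C} (h : E X Y Z) : cls E X - cls E Y + cls E Z = 0 :=
  (QuotientAddGroup.eq_zero_iff _).2 (AddSubgroup.subset_closure ⟨X, Y, Z, h, rfl⟩)

lemma eq_top_of_cls_mem (H : AddSubgroup (K0OfRelation E)) (h : ∀ X, cls E X ∈ H) : H = ⊤ := by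
  rw [eq_top_iff]
  rintro x -
  induction x using QuotientAddGroup.induction_on with | _ x
  induction x using FreeAbelianGroup.induction_on with
  | zero => exact H.zero_mem
  | of x => induction x using _root_.Quotient.inductionOn with | _ X => exact h X
  | neg x hx => exact H.neg_mem hx
  | add x y hx hy => exact H.add_mem hx hy

/-- The universal property of a Grothendieck group. -/
def lift {G : Type*} [AddCommGroup G] (c : C → G) (iso : ∀ X Y : C, (X ≅ Y) → c X = c Y)
    (rel : ∀ X Y Z, E X Y Z → c X - c Y + c Z = 0) : K0OfRelation E →+ G :=
  QuotientAddGroup.lift _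
    (FreeAbelianGroup.lift (_root_.Quotient.lift c fun X Y ⟨e⟩ => iso X Y e)) <| by
    rw [AddSubgroup.closure_le]
    rintro _ ⟨X, Y, Z, h, rfl⟩
    simpa using! rel X Y Z h

@[simp]
lemma lift_cls {G : Type*} [AddCommGroup G] (c : C → G) (iso : ∀ X Y : C, (X ≅ Y) → c X = c Y)
    (rel : ∀ X Y Z, E X Y Z → c X - c Y + c Z = 0) (X : C) :
    lift c iso rel (cls E X) = c X :=
  FreeAbelianGroup.lift_apply_of _ _

end K0OfRelation

end GrothendieckGroup

/-! ### Additive functions on an abelian category -/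

section Additive

open scoped ZeroObject

variable {A : Type u} [Category.{v} A] [Abelian A] {G : Type*} [AddCommGroup G]

/-- A function on the objects of an abelian category is additive if it is so on short exact
sequences. -/
def IsAdditive (c : A → G) : Prop :=
  ∀ ⦃X Y Z : A⦄, FitsInShortExact X Y Z → c X - c Y + c Z = 0

namespace IsAdditive

variable {c : A → G} (hc : IsAdditive c)
include hc

lemma of_shortExact {S : ShortComplex A} (hS : S.ShortExact) : c S.X₂ = c S.X₁ + c S.X₃ := by
  have := hc ⟨S.f, S.g, S.zero, hS⟩
  rw [sub_add_eq_add_sub, sub_eq_zero] at this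
  exact this.symm

lemma of_isZero {X : A} (hX : IsZero X) : c X = 0 := by
  have hS : (ShortComplex.mk (0 : X ⟶ X) (0 : X ⟶ X) (by simp)).ShortExact :=
    { exact := ShortComplex.exact_of_isZero_X₂ _ hX
      mono_f := ⟨fun _ _ _ => hX.eq_of_tgt _ _⟩
      epi_g := ⟨fun _ _ _ => hX.eq_of_src _ _⟩ }
  simpa using hc.of_shortExact hS

lemma of_iso {X Y : A} (e : X ≅ Y) : c X = c Y := by
  have hS : (ShortComplex.mk e.hom (0 : Y ⟶ (0 : A)) (by simp)).ShortExact :=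
    { exact := (ShortComplex.exact_iff_epi _ rfl).2 inferInstance
      mono_f := inferInstance
      epi_g := ⟨fun _ _ _ => (isZero_zero A).eq_of_src _ _⟩ }
  have := hc.of_shortExact hS
  rw [hc.of_isZero (isZero_zero A), add_zero] at this
  exact this.symm

lemma biprod (X Y : A) : c (X ⊞ Y) = c X + c Y :=
  hc.of_shortExact (S := .mk (biprod.inl : X ⟶ X ⊞ Y) biprod.snd (by simp))
    (ShortComplex.Splitting.shortExact ⟨biprod.fst, biprod.inr, by simp, by simp, by simp⟩)

end IsAdditive

end Additive

/-! ### Euler characteristics of periodic complexes -/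

section EulerCharacteristic

variable {A : Type u} [Category.{v} A] [Abelian A] {G : Type*} [AddCommGroup G] {c : A → G}

lemma IsAdditive.cycles_eq {ι : Type*} {σ : ComplexShape ι} (hc : IsAdditive c)
    (K : HomologicalComplex A σ) (i : ι) :
    c (K.cycles i) = c (kernel (K.homologyπ i)) + c (K.homology i) :=
  hc.of_shortExact (S := .mk (kernel.ι (K.homologyπ i)) (K.homologyπ i) (by simp))
    { exact := ShortComplex.exact_of_f_is_kernel _ (kernelIsKernel _)
      mono_f := inferInstance
      epi_g := inferInstance }

/-- The sequence `0 ⟶ Zⁱ ⟶ Kⁱ ⟶ Bʲ ⟶ 0` is exact, where the boundaries `Bʲ` are encoded as the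
kernel of the projection from the cycles to the homology. -/
lemma IsAdditive.X_eq {ι : Type*} {σ : ComplexShape ι} (hc : IsAdditive c)
    (K : HomologicalComplex A σ) {i j : ι} (hij : σ.Rel i j) :
    c (K.X i) = c (K.cycles i) + c (kernel (K.homologyπ j)) := by
  let p : K.X i ⟶ kernel (K.homologyπ j) := kernel.lift _ (K.toCycles i j) (by simp)
  have hp : p ≫ kernel.ι _ ≫ K.iCycles j = K.d i j := by simp [p]
  have w : K.iCycles i ≫ p = 0 := by
    rw [← cancel_mono (kernel.ι (K.homologyπ j) ≫ K.iCycles j)]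
    simp [hp]
  have : Epi p := by
    have := ShortComplex.exact_of_g_is_cokernel
      (ShortComplex.mk (K.toCycles i j) (K.homologyπ j) (by simp))
      (K.homologyIsCokernel i j (σ.prev_eq' hij))
    exact (ShortComplex.exact_iff_epi_kernel_lift _).1 this
  refine hc.of_shortExact (S := .mk (K.iCycles i) p w)
    { exact := ?_
      mono_f := inferInstanceAs (Mono (K.iCycles i))
      epi_g := this }
  let φ : ShortComplex.mk (K.iCycles i) p w ⟶ ShortComplex.mk (K.iCycles i) (K.d i j) (by simp) :=
    { τ₁ := 𝟙 _
      τ₂ := 𝟙 _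
      τ₃ := kernel.ι _ ≫ K.iCycles j
      comm₂₃ := by simp [hp] }
  have : Epi φ.τ₁ := inferInstanceAs (Epi (𝟙 _))
  have : IsIso φ.τ₂ := inferInstanceAs (IsIso (𝟙 _))
  have : Mono φ.τ₃ := inferInstanceAs (Mono (kernel.ι _ ≫ K.iCycles j))
  exact (ShortComplex.exact_iff_of_epi_of_isIso_of_mono φ).2
    (ShortComplex.exact_of_f_is_kernel _ (K.cyclesIsKernel i j (σ.next_eq' hij)))

variable {m : ℕ} [NeZero m] {s : ZMod m → ℤ}

/-- The sign condition `s (i + 1) • g = -(s i • g)` covers both parities of `m`: for even `m` it is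
satisfied by `s i = (-1) ^ i`, and for odd `m` by `s = 1` if `G` is killed by `2`. -/
lemma sum_sign_smul_add_one (hs : ∀ i (g : G), s (i + 1) • g = -(s i • g)) (b : ZMod m → G) :
    ∑ i, s i • b (i + 1) = -∑ i, s i • b i := by
  rw [← Equiv.sum_comp (Equiv.addRight (1 : ZMod m)) (fun i => s i • b i),
    ← Finset.sum_neg_distrib]
  exact Finset.sum_congr rfl fun i _ => by simp [hs]

/-- The Euler characteristic of a complex is that of its homology. -/
lemma IsAdditive.sum_homology_eq (hc : IsAdditive c)
    (hs : ∀ i (g : G), s (i + 1) • g = -(s i • g)) (K : PeriodicComplex A m) :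
    ∑ i, s i • c (K.homology i) = ∑ i, s i • c (K.X i) := by
  have h := sum_sign_smul_add_one hs (fun i => c (kernel (K.homologyπ i)))
  have e (i : ZMod m) : c (K.X i) = c (kernel (K.homologyπ i)) + c (K.homology i) +
      c (kernel (K.homologyπ (i + 1))) := by
    rw [← hc.cycles_eq, hc.X_eq K (j := i + 1) rfl]
  simp only [e, smul_add, Finset.sum_add_distrib, h]
  abel

/-- The mapping cone is `K (i + 1) ⊞ L i` in degree `i`, and shifting the degree by one changes the
sign. -/
lemma IsAdditive.sum_cone (hc : IsAdditive c)
    (hs : ∀ i (g : G), s (i + 1) • g = -(s i • g)) {K L : PeriodicComplex A m} (φ : K ⟶ L) :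
    ∑ i, s i • c (K.X i) - ∑ i, s i • c (L.X i) +
      ∑ i, s i • c ((HomologicalComplex.homotopyCofiber φ).X i) = 0 := by
  have e (i : ZMod m) : c ((HomologicalComplex.homotopyCofiber φ).X i) =
      c (K.X (i + 1)) + c (L.X i) := by
    rw [← hc.biprod]
    exact hc.of_iso (HomologicalComplex.homotopyCofiber.XIsoBiprod φ i (i + 1) rfl)
  have h := sum_sign_smul_add_one hs (fun i => c (K.X i))
  simp only [e, smul_add, Finset.sum_add_distrib, h]
  abel

/-- The homology in degree `i`, as a functor on the periodic derived category. -/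
noncomputable def derivedHomology (A : Type u) [Category.{v} A] [Abelian A] (m : ℕ) (i : ZMod m) :
    PeriodicDerivedCategory A m ⥤ A :=
  Localization.lift (HomotopyCategory.homologyFunctor A (ComplexShape.up (ZMod m)) i)
    (HomotopyCategory.homologyFunctor_inverts_quasiIso A _ i)
    (HomotopyCategory.quasiIso A (ComplexShape.up (ZMod m))).Q

/-- The homology of a complex, viewed in the periodic derived category, is its usual homology. -/
noncomputable def derivedHomologyObjIso {m : ℕ} (K : PeriodicComplex A m) (i : ZMod m) :
    (derivedHomology A m i).obj ((toDerived A m).obj K) ≅ K.homology i :=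
  (Localization.fac _ _ _).app _ ≪≫ (HomotopyCategory.homologyFunctorFactors A _ i).app K

/-- The Euler characteristic of an object of the periodic derived category. It is defined through
homology, so that its invariance under isomorphisms is clear. -/
noncomputable def eulerChar (c : A → G) (s : ZMod m → ℤ) (X : PeriodicDerivedCategory A m) : G :=
  ∑ i, s i • c ((derivedHomology A m i).obj X)

lemma IsAdditive.eulerChar_toDerived (hc : IsAdditive c)
    (hs : ∀ i (g : G), s (i + 1) • g = -(s i • g)) (K : PeriodicComplex A m) :
    eulerChar c s ((toDerived A m).obj K) = ∑ i, s i • c (K.X i) := by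
  rw [← hc.sum_homology_eq hs]
  exact Finset.sum_congr rfl fun i _ => by rw [hc.of_iso (derivedHomologyObjIso K i)]

lemma IsAdditive.eulerChar_of_iso (hc : IsAdditive c) {X Y : PeriodicDerivedCategory A m}
    (e : X ≅ Y) : eulerChar c s X = eulerChar c s Y :=
  Finset.sum_congr rfl fun i _ => by rw [hc.of_iso ((derivedHomology A m i).mapIso e)]

lemma IsAdditive.eulerChar_of_fitsInTriangle (hc : IsAdditive c)
    (hs : ∀ i (g : G), s (i + 1) • g = -(s i • g)) {X Y Z : PeriodicDerivedCategory A m}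
    (h : FitsInTriangle (exactTriangles A m) X Y Z) :
    eulerChar c s X - eulerChar c s Y + eulerChar c s Z = 0 := by
  obtain ⟨_, _, _, K, L, φ, ⟨e⟩⟩ := h
  have e₁ : X ≅ (toDerived A m).obj K := Triangle.π₁.mapIso e
  have e₂ : Y ≅ (toDerived A m).obj L := Triangle.π₂.mapIso e
  have e₃ : Z ≅ (toDerived A m).obj (HomologicalComplex.homotopyCofiber φ) :=
    Triangle.π₃.mapIso e
  rw [hc.eulerChar_of_iso e₁, hc.eulerChar_of_iso e₂, hc.eulerChar_of_iso e₃,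
    hc.eulerChar_toDerived hs, hc.eulerChar_toDerived hs, hc.eulerChar_toDerived hs,
    hc.sum_cone hs]

lemma IsAdditive.eulerChar_stalk (hc : IsAdditive c)
    (hs : ∀ i (g : G), s (i + 1) • g = -(s i • g)) (hs₀ : s 0 = 1) (M : A) :
    eulerChar c s ((stalkFunctor A m).obj M) = c M := by
  refine (hc.eulerChar_toDerived hs _).trans ?_
  rw [Finset.sum_eq_single 0, hs₀, one_smul]
  · exact hc.of_iso (HomologicalComplex.singleObjXSelf _ 0 M)
  · intro i _ hi
    rw [hc.of_isZero (HomologicalComplex.isZero_single_obj_X _ 0 M i hi), smul_zero]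
  · simp

end EulerCharacteristic

/-! ### Exact triangles from short exact sequences of complexes -/

section ShortExact

variable {A : Type u} [Category.{v} A] [Abelian A] {m : ℕ}

open HomologicalComplex

/-- The map `cone (X₁ ⟶ X₂) ⟶ X₃` attached to a short complex `X₁ ⟶ X₂ ⟶ X₃`: it is zero on the
summand coming from `X₁`. -/
noncomputable def coneDesc (S : ShortComplex (PeriodicComplex A m)) :
    homotopyCofiber S.f ⟶ S.X₃ :=
  homotopyCofiber.desc S.f S.g (Homotopy.ofEq S.zero)

lemma coneDesc_f (S : ShortComplex (PeriodicComplex A m)) (i : ZMod m) :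
    (coneDesc S).f i = homotopyCofiber.sndX S.f i ≫ S.g.f i := by
  rw [coneDesc, homotopyCofiber.desc_f _ _ _ i (i + 1) rfl]
  simp [Homotopy.ofEq]

lemma quasiIso_coneDesc {S : ShortComplex (PeriodicComplex A m)} (hS : S.ShortExact) :
    QuasiIso (coneDesc S) := by
  have hSi (i : ZMod m) : (S.map (eval A _ i)).ShortExact := hS.map_of_exact _
  have hf (i : ZMod m) : Mono (S.f.f i) := (hSi i).mono_f
  have hg (i : ZMod m) : Epi (S.g.f i) := (hSi i).epi_g
  have lift (i : ZMod m) {T : A} (b : T ⟶ S.X₂.X i) (hb : b ≫ S.g.f i = 0) :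
      ∃ a : T ⟶ S.X₁.X i, a ≫ S.f.f i = b :=
    have := (hSi i).mono_f
    ⟨(hSi i).exact.lift b hb, (hSi i).exact.lift_f b hb⟩
  refine ⟨fun i => ?_⟩
  rw [quasiIsoAt_iff_isIso_homologyMap]
  -- `h` precedes `i`, and `j`, `k` follow it
  obtain ⟨h, rfl⟩ : ∃ h, i = h + 1 := ⟨i - 1, by simp⟩
  generalize hi : h + 1 = i
  generalize hj : i + 1 = j
  generalize hk : j + 1 = k
  have rh : (ComplexShape.up (ZMod m)).Rel h i := hi
  have ri : (ComplexShape.up (ZMod m)).Rel i j := hj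
  have rj : (ComplexShape.up (ZMod m)).Rel j k := hk
  have hmono : Mono (homologyMap (coneDesc S) i) := by
    rw [mono_homologyMap_iff_up_to_refinements _ h i j (ComplexShape.prev_eq' _ rh)
      (ComplexShape.next_eq' _ ri)]
    intro T x hx z hz
    -- a cycle `(x₁, x₂)` with `g x₂ = d z` and `z = g y` is the boundary of `(a, y)`, where
    -- `x₂ - d y = f a`
    obtain ⟨T', π, hπ, y, hy⟩ := surjective_up_to_refinements_of_epi (S.g.f h) z
    have hx₁ := congr($hx ≫ homotopyCofiber.fstX S.f j k rj)
    have hx₂ := congr($hx ≫ homotopyCofiber.sndX S.f j)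
    rw [assoc, zero_comp, homotopyCofiber_d, homotopyCofiber.d_fstX _ _ _ _ ri rj] at hx₁
    rw [assoc, zero_comp, homotopyCofiber_d, homotopyCofiber.d_sndX _ _ _ ri] at hx₂
    rw [coneDesc_f] at hz
    obtain ⟨a, ha⟩ := lift i (π ≫ x ≫ homotopyCofiber.sndX S.f i - y ≫ S.X₂.d h i) (by
      simp [hz, reassoc_of% hy])
    refine ⟨T', π, hπ, a ≫ homotopyCofiber.inlX S.f i h rh + y ≫ homotopyCofiber.inrX S.f h, ?_⟩
    apply homotopyCofiber.ext_to_X S.f i j ri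
    · rw [← cancel_mono (S.f.f j)]
      have := congr($ha ≫ S.X₂.d i j)
      simp only [assoc, Hom.comm, Preadditive.sub_comp, d_comp_d, comp_zero, sub_zero] at this
      simp [homotopyCofiber.inlX_d _ _ _ _ rh ri, this]
      rw [Preadditive.comp_add, ← eq_neg_iff_add_eq_zero] at hx₂
      simp [hx₂]
    · simp [homotopyCofiber.inlX_d _ _ _ _ rh ri, ha]
  have hepi : Epi (homologyMap (coneDesc S) i) := by
    rw [epi_homologyMap_iff_up_to_refinements _ h i j (ComplexShape.prev_eq' _ rh)
      (ComplexShape.next_eq' _ ri)]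
    intro T z hz
    -- a cycle `z = g b` is the image of the cycle `(-a, b)`, where `d b = f a`
    obtain ⟨T', π, hπ, b, hb⟩ := surjective_up_to_refinements_of_epi (S.g.f i) z
    obtain ⟨a, ha⟩ := lift j (b ≫ S.X₂.d i j) (by
      rw [assoc, ← Hom.comm, ← reassoc_of% hb, hz, comp_zero])
    have ha' : a ≫ S.X₁.d j k = 0 := by
      rw [← cancel_mono (S.f.f k)]
      rw [assoc, ← Hom.comm, reassoc_of% ha, d_comp_d, comp_zero, zero_comp]
    refine ⟨T', π, hπ, -a ≫ homotopyCofiber.inlX S.f j i ri + b ≫ homotopyCofiber.inrX S.f i,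
      ?_, 0, ?_⟩
    · simp [homotopyCofiber.inlX_d _ _ _ _ ri rj, reassoc_of% ha, reassoc_of% ha']
    · simp [coneDesc_f, hb]
  exact isIso_of_mono_of_epi _

/-- The third object of a triangle can be replaced by an isomorphic one. -/
lemma fitsInTriangle_of_iso {D : Type*} [Category* D] [HasShift D ℤ] {T : Triangle D}
    {dist : Set (Triangle D)} (h : ∀ T', Nonempty (T' ≅ T) → T' ∈ dist) {Z : D}
    (e : T.obj₃ ≅ Z) : FitsInTriangle dist T.obj₁ T.obj₂ Z :=
  ⟨T.mor₁, T.mor₂ ≫ e.hom, e.inv ≫ T.mor₃,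
    h _ ⟨Triangle.isoMk _ _ (Iso.refl _) (Iso.refl _) e.symm
      (by change T.mor₁ ≫ 𝟙 _ = 𝟙 _ ≫ T.mor₁; simp)
      (by change (T.mor₂ ≫ e.hom) ≫ e.inv = 𝟙 _ ≫ T.mor₂; simp)
      (by change (e.inv ≫ T.mor₃) ≫ (shiftFunctor D (1 : ℤ)).map (𝟙 _) = e.inv ≫ T.mor₃; simp)⟩⟩

/-- A short exact sequence of periodic complexes yields an exact triangle. -/
lemma fitsInTriangle_of_shortExact {S : ShortComplex (PeriodicComplex A m)} (hS : S.ShortExact) :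
    FitsInTriangle (exactTriangles A m) ((toDerived A m).obj S.X₁) ((toDerived A m).obj S.X₂)
      ((toDerived A m).obj S.X₃) := by
  have := quasiIso_coneDesc hS
  have hq : IsIso ((toDerived A m).map (coneDesc S)) :=
    Localization.inverts (HomotopyCategory.quasiIso A (ComplexShape.up (ZMod m))).Q _ _
      ((HomotopyCategory.quotient_map_mem_quasiIso_iff _).2 this)
  exact fitsInTriangle_of_iso (dist := exactTriangles A m)
    (T := (toDerived A m).mapTriangle.obj (coneTriangle A m S.f))
    (fun _ h => ⟨S.X₁, S.X₂, S.f, h⟩) (@asIso _ _ _ _ _ hq)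

end ShortExact

/-! ### Generation by stalk complexes -/

section Generation

open scoped ZeroObject

variable {A : Type u} [Category.{v} A] [Abelian A] {m : ℕ}

open HomologicalComplex

/-- The class of a periodic complex in the Grothendieck group of the periodic derived category. -/
noncomputable abbrev complexClass (K : PeriodicComplex A m) : K0PeriodicDerived A m :=
  K0OfRelation.cls _ ((toDerived A m).obj K)

lemma complexClass_of_iso {K L : PeriodicComplex A m} (e : K ≅ L) :
    complexClass K = complexClass L :=
  K0OfRelation.cls_eq_of_iso ((toDerived A m).mapIso e)

lemma isAdditive_complexClass : IsAdditive (complexClass (A := A) (m := m)) :=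
  fun _ _ _ ⟨_, _, _, hS⟩ => K0OfRelation.cls_sub_cls_add_cls (fitsInTriangle_of_shortExact hS)

lemma isAdditive_single (i : ZMod m) :
    IsAdditive fun M : A => complexClass ((single A (ComplexShape.up (ZMod m)) i).obj M) :=
  fun _ _ _ ⟨_, _, _, hS⟩ => K0OfRelation.cls_sub_cls_add_cls
    (fitsInTriangle_of_shortExact (hS.map_of_exact (single A (ComplexShape.up (ZMod m)) i)))

lemma complexClass_cone {K L : PeriodicComplex A m} (φ : K ⟶ L) :
    complexClass K - complexClass L + complexClass (homotopyCofiber φ) = 0 :=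
  K0OfRelation.cls_sub_cls_add_cls ⟨_, _, _, K, L, φ, ⟨Iso.refl _⟩⟩

lemma isZero_of_X {K : PeriodicComplex A m} (hK : ∀ i, IsZero (K.X i)) : IsZero K := by
  rw [IsZero.iff_id_eq_zero]
  ext i
  exact (hK i).eq_of_src _ _

/-- The projection to degree `a` of a complex with zero differential. -/
noncomputable def toSingle (K : PeriodicComplex A m) (hd : ∀ i j, K.d i j = 0) (a : ZMod m) :
    K ⟶ (single A _ a).obj (K.X a) :=
  mkHomToSingle (𝟙 _) (fun i _ => by simp [hd])

lemma isIso_toSingle_f (K : PeriodicComplex A m) (hd : ∀ i j, K.d i j = 0) (a : ZMod m) :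
    IsIso ((toSingle K hd a).f a) := by
  rw [toSingle, mkHomToSingle_f]
  infer_instance

lemma isIso_toSingle (K : PeriodicComplex A m) (hd : ∀ i j, K.d i j = 0) (a : ZMod m)
    (ha : ∀ i, i ≠ a → IsZero (K.X i)) : IsIso (toSingle K hd a) := by
  have (i : ZMod m) : IsIso ((toSingle K hd a).f i) := by
    by_cases h : i = a
    · subst h; exact isIso_toSingle_f K hd i
    · exact ⟨0, (ha i h).eq_of_src _ _, (isZero_single_obj_X _ _ _ _ h).eq_of_src _ _⟩
  exact Hom.isIso_of_components _

/-- The mapping cone of the zero map from the stalk complex in degree `i + 1` to `0` is the stalk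
complex in degree `i`. This also holds for `m = 1`, where the two degrees agree. -/
lemma complexClass_single (M : A) (i : ZMod m) :
    complexClass ((single A _ i).obj M) = -complexClass ((single A _ (i + 1)).obj M) := by
  let K := (single A (ComplexShape.up (ZMod m)) (i + 1)).obj M
  let φ : K ⟶ 0 := 0
  let C := homotopyCofiber φ
  have hz (j : ZMod m) : IsZero ((0 : PeriodicComplex A m).X j) :=
    (eval A _ j).map_isZero (isZero_zero _)
  have hd (j k : ZMod m) : C.d j k = 0 := by
    by_cases hjk : (ComplexShape.up (ZMod m)).Rel j k
    · apply homotopyCofiber.ext_to_X φ k (k + 1) rfl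
      · change homotopyCofiber.d φ j k ≫ _ = _
        rw [homotopyCofiber.d_fstX φ j k (k + 1) hjk rfl]
        simp [K]
      · exact (hz k).eq_of_tgt _ _
    · exact C.shape _ _ hjk
  have e (j : ZMod m) : C.X j ≅ K.X (j + 1) :=
    homotopyCofiber.XIsoBiprod φ j (j + 1) rfl ≪≫ (isoBiprodZero (hz j)).symm
  have := isIso_toSingle C hd i fun j hj =>
    (isZero_single_obj_X _ _ _ _ (by simpa using hj)).of_iso (e j)
  have h := complexClass_cone φ
  rw [isAdditive_complexClass.of_isZero (isZero_zero _),
    complexClass_of_iso (asIso (toSingle C hd i)), sub_zero, add_comm,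
    (isAdditive_single i).of_iso (e i ≪≫ singleObjXSelf _ _ _)] at h
  exact eq_neg_of_add_eq_zero_left h

/-- For `n = m`, where the degree on the right is again `0`, this says that the class of a stalk
complex is killed by `2` if `m` is odd. -/
lemma complexClass_single_zero (M : A) (n : ℕ) :
    complexClass ((single A (ComplexShape.up (ZMod m)) 0).obj M) =
      (-1 : ℤ) ^ n • complexClass ((single A (ComplexShape.up (ZMod m)) (n : ZMod m)).obj M) := by
  induction n with
  | zero => simp
  | succ n ih => rw [ih, complexClass_single]; simp [pow_succ]

/-- Every class is a combination of classes of stalk complexes in degree `0`: a complex is an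
extension of two complexes with zero differential, its cycles and its boundaries, and a complex with
zero differential is an iterated extension of stalk complexes. -/
lemma cls_mem_of_stalk_mem [NeZero m] (H : AddSubgroup (K0PeriodicDerived A m))
    (h : ∀ M : A, K0OfRelation.cls _ ((stalkFunctor A m).obj M) ∈ H)
    (X : PeriodicDerivedCategory A m) : K0OfRelation.cls _ X ∈ H := by
  have hsingle (M : A) (i : ZMod m) : complexClass ((single A _ i).obj M) ∈ H := by
    have h₁ := H.zsmul_mem (h M) ((-1) ^ i.val)
    change _ • complexClass ((single A (ComplexShape.up (ZMod m)) 0).obj M) ∈ H at h₁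
    rwa [complexClass_single_zero M i.val, smul_smul, ← mul_pow, neg_mul_neg, one_mul, one_pow,
      one_smul, ZMod.natCast_zmod_val] at h₁
  -- complexes with zero differential, by induction on the set of degrees where they live
  have hzero (s : Finset (ZMod m)) : ∀ K : PeriodicComplex A m, (∀ i j, K.d i j = 0) →
      (∀ i ∉ s, IsZero (K.X i)) → complexClass K ∈ H := by
    induction s using Finset.induction_on with
    | empty =>
      intro K _ hK
      rw [isAdditive_complexClass.of_isZero (isZero_of_X fun i => hK i (by simp))]
      exact H.zero_mem
    | insert a s has ih =>
      intro K hd hK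
      let f := toSingle K hd a
      have : Epi f := by
        have (i : ZMod m) : Epi (f.f i) := by
          by_cases hi : i = a
          · subst hi
            have := isIso_toSingle_f K hd i
            infer_instance
          · exact ⟨fun _ _ _ => (isZero_single_obj_X _ _ _ _ hi).eq_of_src _ _⟩
        exact epi_of_epi_f _ this
      have hS : (ShortComplex.mk (kernel.ι f) f (by simp)).ShortExact :=
        { exact := ShortComplex.exact_of_f_is_kernel _ (kernelIsKernel _)
          mono_f := inferInstance
          epi_g := this }
      rw [isAdditive_complexClass.of_shortExact hS]
      refine H.add_mem (ih _ (fun i j => ?_) fun i hi => ?_) (hsingle _ _)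
      · rw [← cancel_mono ((kernel.ι f).f j), ← Hom.comm, hd, comp_zero, zero_comp]
      · by_cases hia : i = a
        · subst hia
          have h₁ : (kernel.ι f).f i ≫ f.f i = 0 := by
            rw [← comp_f, kernel.condition, zero_f]
          have := isIso_toSingle_f K hd i
          rw [IsZero.iff_id_eq_zero, ← cancel_mono ((kernel.ι f).f i), ← cancel_mono (f.f i)]
          simp [h₁]
        · exact (hK i (by simp [hia, hi])).of_mono ((kernel.ι f).f i)
  obtain ⟨K, rfl⟩ := (Localization.Construction.objEquiv _).surjective X
  obtain ⟨K, rfl⟩ := HomotopyCategory.quotient_obj_surjective K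
  change complexClass K ∈ H
  -- the subcomplex of cycles; the differential of the quotient is zero as `d` takes values in it
  let Z : PeriodicComplex A m :=
    { X := fun i => K.cycles i
      d := fun _ _ => 0 }
  let ι : Z ⟶ K :=
    { f := fun i => K.iCycles i
      comm' := by simp [Z] }
  have (i : ZMod m) : Mono (ι.f i) := inferInstanceAs (Mono (K.iCycles i))
  have : Mono ι := mono_of_mono_f _ this
  have hS : (ShortComplex.mk ι (cokernel.π ι) (by simp)).ShortExact :=
    { exact := ShortComplex.exact_of_g_is_cokernel _ (cokernelIsCokernel _)
      mono_f := this
      epi_g := inferInstance }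
  rw [isAdditive_complexClass.of_shortExact hS]
  refine H.add_mem (hzero Finset.univ _ (fun _ _ => rfl) (by simp))
    (hzero Finset.univ _ (fun i j => ?_) (by simp))
  have h₁ : K.iCycles j ≫ (cokernel.π ι).f j = 0 := by
    have := congr_hom (cokernel.condition ι) j
    exact this
  rw [← cancel_epi ((cokernel.π ι).f i), Hom.comm, comp_zero, ← K.toCycles_i, assoc, h₁, comp_zero]

end Generation

/-! ### The isomorphisms of Grothendieck groups -/

section Isomorphism

variable {A : Type u} [Category.{v} A] [Abelian A] {m : ℕ}

lemma isAdditive_cls : IsAdditive (K0OfRelation.cls (FitsInShortExact (A := A))) :=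
  fun _ _ _ => K0OfRelation.cls_sub_cls_add_cls

/-- The homomorphism of Grothendieck groups induced by the stalk functor. -/
noncomputable def stalkHom (A : Type u) [Category.{v} A] [Abelian A] (m : ℕ) :
    K0Abelian A →+ K0PeriodicDerived A m :=
  K0OfRelation.lift (fun M => K0OfRelation.cls _ ((stalkFunctor A m).obj M))
    (fun _ _ e => K0OfRelation.cls_eq_of_iso ((stalkFunctor A m).mapIso e))
    fun _ _ _ h => isAdditive_single 0 h

@[simp]
lemma stalkHom_cls (M : A) : stalkHom A m (K0OfRelation.cls _ M) =
    K0OfRelation.cls _ ((stalkFunctor A m).obj M) :=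
  K0OfRelation.lift_cls _ _ _ _

lemma stalkHom_surjective [NeZero m] : Function.Surjective (stalkHom A m) := by
  rw [← AddMonoidHom.range_eq_top]
  exact K0OfRelation.eq_top_of_cls_mem _
    (cls_mem_of_stalk_mem _ fun M => ⟨K0OfRelation.cls _ M, stalkHom_cls M⟩)

/-- The Euler characteristic descends to a homomorphism which inverts the stalk functor on
classes. -/
lemma exists_eulerHom [NeZero m] {G : Type*} [AddCommGroup G] {c : A → G} (hc : IsAdditive c)
    {s : ZMod m → ℤ} (hs : ∀ i (g : G), s (i + 1) • g = -(s i • g)) (hs₀ : s 0 = 1) :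
    ∃ χ : K0PeriodicDerived A m →+ G,
      ∀ M : A, χ (K0OfRelation.cls _ ((stalkFunctor A m).obj M)) = c M :=
  ⟨K0OfRelation.lift (eulerChar c s) (fun _ _ => hc.eulerChar_of_iso)
    (fun _ _ _ => hc.eulerChar_of_fitsInTriangle hs), fun M => by
      rw [K0OfRelation.lift_cls, hc.eulerChar_stalk hs hs₀]⟩

lemma exists_sign (hm : Even m) :
    ∃ s : ZMod m → ℤ, (∀ i, s (i + 1) = -s i) ∧ s 0 = 1 := by
  -- the parity of a residue class modulo `m`
  let r := ZMod.castHom hm.two_dvd (ZMod 2)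
  refine ⟨fun i => if r i = 0 then 1 else -1, fun i => ?_, by simp⟩
  simp only [map_add, map_one]
  generalize r i = t
  revert t
  decide

lemma exists_equiv_of_even [NeZero m] (hm : Even m) :
    ∃ e : K0Abelian A ≃+ K0PeriodicDerived A m, ∀ M : A, e (K0OfRelation.cls _ M) =
      K0OfRelation.cls _ ((stalkFunctor A m).obj M) := by
  obtain ⟨s, hs, hs₀⟩ := exists_sign hm
  obtain ⟨χ, hχ⟩ := exists_eulerHom (m := m) (isAdditive_cls (A := A))
    (fun i g => by rw [hs, neg_smul]) hs₀
  have h : (χ.comp (stalkHom A m)).eqLocus (.id _) = ⊤ :=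
    K0OfRelation.eq_top_of_cls_mem _ fun M => by
      change χ (stalkHom A m _) = _
      rw [stalkHom_cls, hχ]
      rfl
  have hinj : Function.LeftInverse χ (stalkHom A m) := fun x => h.ge (AddSubgroup.mem_top x)
  exact ⟨.ofBijective _ ⟨hinj.injective, stalkHom_surjective⟩, stalkHom_cls⟩

lemma two_nsmul_eq_zero [NeZero m] (hm : Odd m) (x : K0PeriodicDerived A m) : 2 • x = 0 := by
  have h : (nsmulAddMonoidHom (α := K0PeriodicDerived A m) 2).ker = ⊤ :=
    K0OfRelation.eq_top_of_cls_mem _ <| cls_mem_of_stalk_mem _ fun M => by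
      have := complexClass_single_zero (m := m) M m
      rw [hm.neg_one_pow, neg_one_smul, ZMod.natCast_self, eq_neg_iff_add_eq_zero,
        ← two_nsmul] at this
      exact this
  exact h.ge (AddSubgroup.mem_top x)

lemma exists_equiv_of_odd [NeZero m] (hm : Odd m) :
    ∃ e : K0Abelian A ⊗[ℤ] ZMod 2 ≃+ K0PeriodicDerived A m, ∀ M : A,
      e (K0OfRelation.cls _ M ⊗ₜ[ℤ] (1 : ZMod 2)) =
        K0OfRelation.cls _ ((stalkFunctor A m).obj M) := by
  let c (M : A) : K0Abelian A ⊗[ℤ] ZMod 2 := K0OfRelation.cls _ M ⊗ₜ[ℤ] (1 : ZMod 2)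
  have hc : IsAdditive c := fun X Y Z h => by
    simp only [c, ← TensorProduct.sub_tmul, ← TensorProduct.add_tmul, isAdditive_cls h,
      TensorProduct.zero_tmul]
  have h2 (g : K0Abelian A ⊗[ℤ] ZMod 2) : g + g = 0 := by
    induction g using TensorProduct.induction_on with
    | zero => simp
    | tmul x y => rw [← TensorProduct.tmul_add, CharTwo.add_self_eq_zero, TensorProduct.tmul_zero]
    | add x y hx hy => rw [add_add_add_comm, hx, hy, add_zero]
  obtain ⟨χ, hχ⟩ := exists_eulerHom (m := m) hc (s := fun _ => 1)
    (fun i g => by simpa using eq_neg_of_add_eq_zero_left (h2 g)) rfl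
  let b : ZMod 2 →+ K0Abelian A →+ K0PeriodicDerived A m :=
    ZMod.lift 2 ⟨(zmultiplesHom _ (stalkHom A m)), by
      refine AddMonoidHom.ext fun x => ?_
      exact (natCast_zsmul _ 2).trans (two_nsmul_eq_zero hm (stalkHom A m x))⟩
  let f : K0Abelian A ⊗[ℤ] ZMod 2 →+ K0PeriodicDerived A m :=
    TensorProduct.liftAddHom b.flip fun n x y => by
      rw [map_zsmul, map_zsmul]
      rfl
  have hf (x : K0Abelian A) : f (x ⊗ₜ 1) = stalkHom A m x := by
    have hb : b 1 = stalkHom A m := by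
      simpa using ZMod.lift_coe 2 ⟨zmultiplesHom _ (stalkHom A m), _⟩ 1
    exact congr($hb x)
  have h : (χ.comp (stalkHom A m)).eqLocus
      ((TensorProduct.mk ℤ (K0Abelian A) (ZMod 2)).flip 1).toAddMonoidHom = ⊤ :=
    K0OfRelation.eq_top_of_cls_mem _ fun M => by
      change χ (stalkHom A m _) = _
      rw [stalkHom_cls, hχ]
      rfl
  have hinj : Function.LeftInverse χ f := fun z => by
    induction z using TensorProduct.induction_on with
    | zero => simp
    | tmul x y =>
      obtain ⟨n, rfl⟩ := ZMod.intCast_surjective y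
      have : x ⊗ₜ[ℤ] (n : ZMod 2) = n • (x ⊗ₜ[ℤ] (1 : ZMod 2)) := by
        rw [← TensorProduct.tmul_smul, zsmul_one]
      rw [this, map_zsmul, map_zsmul, hf]
      congr 1
      exact h.ge (AddSubgroup.mem_top x)
    | add x y hx hy => rw [map_add, map_add, hx, hy]
  have hsurj : Function.Surjective f := fun y => by
    obtain ⟨x, rfl⟩ := stalkHom_surjective y
    exact ⟨_, hf x⟩
  exact ⟨.ofBijective f ⟨hinj.injective, hsurj⟩, fun M => (hf _).trans (stalkHom_cls M)⟩

end Isomorphism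

end PeriodicDerived

theorem theorem1p1 {A : Type u} [Category.{v} A] [Abelian A] [EssentiallySmall.{w} A]
    [EnoughProjectives A] (hA : PeriodicDerived.HasFiniteGlobalDimension A)
    (m : ℕ) (hm : 0 < m) :
    EssentiallySmall.{w} (PeriodicDerived.PeriodicDerivedCategory A m) ∧
    (Even m → ∃ e : PeriodicDerived.K0Abelian A ≃+ PeriodicDerived.K0PeriodicDerived A m,
      ∀ M : A, e (PeriodicDerived.K0OfRelation.cls _ M) =
        PeriodicDerived.K0OfRelation.cls _ ((PeriodicDerived.stalkFunctor A m).obj M)) ∧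
    (Odd m → ∃ e : PeriodicDerived.K0Abelian A ⊗[ℤ] ZMod 2 ≃+
        PeriodicDerived.K0PeriodicDerived A m,
      ∀ M : A, e (PeriodicDerived.K0OfRelation.cls _ M ⊗ₜ[ℤ] (1 : ZMod 2)) =
        PeriodicDerived.K0OfRelation.cls _ ((PeriodicDerived.stalkFunctor A m).obj M)) := by
  have : NeZero m := ⟨hm.ne'⟩
  exact ⟨PeriodicDerived.essentiallySmall_periodicDerivedCategory.{w} A m,
    PeriodicDerived.exists_equiv_of_even, PeriodicDerived.exists_equiv_of_odd⟩
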